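/- A geometric graph is a simple graph drawn in the plane with its vertices at distinct points, no three of them collinear, and its edges drawn as straight-line segments. Let $\mathsf K^c_n$ denote a complete geometric graph on $n$ vertices in convex position. A decomposition $[\mathsf K^c_n,P]$ is a set $P$ of non-empty induced (hence complete) subgraphs such that every edge belongs to exactly one member of $P$. Two members of $P$ have nonempty intersection if they share a vertex or if an edge of one crosses an edge of the other. The chromatic index $\chi'([\mathsf K^c_n,P])$ is the smallest positive integer $m$ for which the edges can be colored with $m$ colors so that all edges of each member of $P$ have the same color and any two distinct members of $P$ with nonempty intersection have different colors. Theorem. Let $n=18k+1$ with $k$ even. For every such $n$ and every complete convex geometric graph $\mathsf K^c_n$ of order $n$ there exists a decomposition $[\mathsf K^c_n,P]$ such that each element of $P$ is a triangle and $$\chi'([\mathsf K^c_n,P])\le \frac{n^2}{36}+\Theta(n),$$ that is, there is a single function $g(n)=\Theta(n)$, depending only on $n$, such that $\chi'([\mathsf K^c_n,P])\le \frac{n^2}{36}+g(n)$. -/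

import Mathlib

/-- A geometric graph with vertex set `V`: a simple graph drawn in the plane with its vertices at
distinct points in general position (no three collinear) and its edges drawn as straight-line
segments. -/
structure GeometricGraph (V : Type*) where
  /-- the underlying abstract graph -/
  graph : SimpleGraph V
  /-- the point at which a vertex is drawn -/
  pos : V → EuclideanSpace ℝ (Fin 2)
  pos_injective : Function.Injective pos
  general_position : ∀ a b c : V, a ≠ b → b ≠ c → a ≠ c →
    ¬ Collinear ℝ {pos a, pos b, pos c}

/-- A decomposition of a simple graph: a set of induced subgraphs, each with at least one edge, such
that every edge of the graph belongs to exactly one of them. -/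
structure GraphDecomposition {V : Type*} (G : SimpleGraph V) where
  parts : Set G.Subgraph
  induced : ∀ H ∈ parts, H.IsInduced
  nonempty : ∀ H ∈ parts, H.edgeSet.Nonempty
  existsUnique_part : ∀ e ∈ G.edgeSet, ∃! H : G.Subgraph, H ∈ parts ∧ e ∈ H.edgeSet

/-- The subgraph is a triangle: three pairwise adjacent vertices. -/
def SimpleGraph.Subgraph.IsTriangle {V : Type*} {G : SimpleGraph V} (H : G.Subgraph) : Prop :=
  H.verts.ncard = 3 ∧ ∀ u ∈ H.verts, ∀ v ∈ H.verts, u ≠ v → H.Adj u v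

namespace GeometricGraph

variable {V : Type*}

/-- The complete geometric graph: any two distinct vertices are adjacent. -/
def IsComplete (K : GeometricGraph V) : Prop :=
  K.graph = ⊤

/-- The vertices are in convex position: no one of them lies in the convex hull of the others. -/
def InConvexPosition (K : GeometricGraph V) : Prop :=
  ConvexIndependent ℝ K.pos

/-- The segments `ab` and `cd` cross: they have a common relative interior point. (By general
position, distinct edges with a common end never do.) -/
def Crosses (K : GeometricGraph V) (a b c d : V) : Prop :=
  (openSegment ℝ (K.pos a) (K.pos b) ∩ openSegment ℝ (K.pos c) (K.pos d)).Nonempty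

/-- Two geometric subgraphs have nonempty intersection: they have a common vertex, or an edge of the
first crosses an edge of the second. -/
def Meet (K : GeometricGraph V) (H₁ H₂ : K.graph.Subgraph) : Prop :=
  (H₁.verts ∩ H₂.verts).Nonempty ∨
    ∃ a b c d : V, H₁.Adj a b ∧ H₂.Adj c d ∧ K.Crosses a b c d

/-- `c` is a `k`-`P`-coloring: every part is monochromatic, and any two distinct parts with nonempty
intersection have different colors. -/
def IsColoring (K : GeometricGraph V) (P : GraphDecomposition K.graph) {k : ℕ}
    (c : K.graph.edgeSet → Fin k) : Prop :=
  (∀ H ∈ P.parts, ∀ e f : K.graph.edgeSet,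
    (e : Sym2 V) ∈ H.edgeSet → (f : Sym2 V) ∈ H.edgeSet → c e = c f) ∧
  (∀ H₁ ∈ P.parts, ∀ H₂ ∈ P.parts, H₁ ≠ H₂ → K.Meet H₁ H₂ → ∀ e f : K.graph.edgeSet,
    (e : Sym2 V) ∈ H₁.edgeSet → (f : Sym2 V) ∈ H₂.edgeSet → c e ≠ c f)

/-- The positive integers `k` for which a `k`-`P`-coloring exists. -/
def colorNumbers (K : GeometricGraph V) (P : GraphDecomposition K.graph) : Set ℕ :=
  {k | 0 < k ∧ ∃ c : K.graph.edgeSet → Fin k, K.IsColoring P c}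

/-- The chromatic index of a decomposition of a geometric graph: the smallest positive integer `k`
for which there is a `k`-`P`-coloring. -/
noncomputable def chromaticIndex (K : GeometricGraph V) (P : GraphDecomposition K.graph) : ℕ :=
  sInf (K.colorNumbers P)

/-- For a finite vertex set some coloring always exists, so the minimum above is attained. -/
theorem colorNumbers_nonempty [Finite V] (K : GeometricGraph V) (P : GraphDecomposition K.graph) :
    (K.colorNumbers P).Nonempty := by
  classical
  have : Finite K.graph.Subgraph :=
    Finite.of_injective (fun H : K.graph.Subgraph => (H.verts, H.Adj)) (by
      intro H₁ H₂ h
      simp only [Prod.mk.injEq] at h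
      exact SimpleGraph.Subgraph.ext h.1 h.2)
  obtain ⟨m, ⟨φ⟩⟩ := Finite.exists_equiv_fin K.graph.Subgraph
  have hφ : Nonempty (Fin m) := ⟨φ ⊤⟩
  choose p hp hu using P.existsUnique_part
  refine ⟨m, Fin.pos_iff_nonempty.2 hφ, fun e => φ (p e e.2), ?_, ?_⟩
  · intro H hH e f he hf
    exact congrArg φ ((hu e e.2 H ⟨hH, he⟩).symm.trans (hu f f.2 H ⟨hH, hf⟩))
  · intro H₁ h₁ H₂ h₂ hne _ e f he hf h
    exact hne ((hu e e.2 H₁ ⟨h₁, he⟩).trans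
      ((φ.injective h).trans (hu f f.2 H₂ ⟨h₂, hf⟩).symm))

end GeometricGraph

/-! Put `n = 18 * s + 1` with `s` even. Peltesohn's cyclic Steiner triple system consists of the
rotations of `3 * s` base triples whose ordered differences hit every nonzero residue exactly once.
Drawn on the polygon, its triples are triangles that decompose the edges.

For each `j` with `j + 3 ≤ s`, three base triangles, one from each family, can be nested: each lies
in the first gap of the next. The outermost spans `8 * s + 2 * j + 2` steps, so the chains `j` and
`s - 3 - j` together span `18 * s - 2` and fit side by side in one turn. As `s` is even, `j ≠ s - 3
- j`, so the chains pair off. Each pair gives six pairwise disjoint triangles, and rotating it uses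
`n` colors. The six base triangles left over get a color class each. At most `(s / 2 + 6) * n`
colors are needed, which is `n ^ 2 / 36 + O(n)`.

The facts that carry this are `peltesohn_sub_injective` for the decomposition,
`gapSeparated_of_colorClass_eq` for the nesting, and `not_meet`, which turns separated index
intervals into disjoint triangles. -/

/-! ### Signed areas and segments in the plane -/

/-- Twice the signed area of the triangle `abc`. -/
def signedArea (a b c : EuclideanSpace ℝ (Fin 2)) : ℝ :=
  (b 0 - a 0) * (c 1 - a 1) - (b 1 - a 1) * (c 0 - a 0)

theorem signedArea_rotate (a b c : EuclideanSpace ℝ (Fin 2)) :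
    signedArea b c a = signedArea a b c := by
  unfold signedArea; ring

theorem signedArea_swap (a b c : EuclideanSpace ℝ (Fin 2)) :
    signedArea a c b = -signedArea a b c := by
  unfold signedArea; ring

theorem collinear_of_signedArea_eq_zero {a b c : EuclideanSpace ℝ (Fin 2)} (hab : a ≠ b)
    (h : signedArea a b c = 0) : Collinear ℝ {a, b, c} := by
  rw [collinear_iff_of_mem (p₀ := a) (by simp)]
  refine ⟨b - a, ?_⟩
  unfold signedArea at h
  have hc : ∃ r : ℝ, c = r • (b - a) +ᵥ a := by
    by_cases h0 : b 0 - a 0 = 0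
    · have h1 : b 1 - a 1 ≠ 0 := by
        intro h1
        apply hab
        ext i
        fin_cases i
        · simpa using (sub_eq_zero.1 h0).symm
        · simpa using (sub_eq_zero.1 h1).symm
      refine ⟨(c 1 - a 1) / (b 1 - a 1), ?_⟩
      ext i
      fin_cases i
      · have : c 0 - a 0 = 0 := by
          rw [h0] at h
          have : (b 1 - a 1) * (c 0 - a 0) = 0 := by linarith
          exact (mul_eq_zero.1 this).resolve_left h1
        simp [h0]
        linarith
      · simp
        field_simp
        ring
    · refine ⟨(c 0 - a 0) / (b 0 - a 0), ?_⟩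
      ext i
      fin_cases i
      · simp
        field_simp
        ring
      · simp
        field_simp
        linarith
  rintro p (rfl | rfl | rfl)
  · exact ⟨0, by simp⟩
  · exact ⟨1, by simp⟩
  · exact hc

theorem signedArea_lineMap (a b c d : EuclideanSpace ℝ (Fin 2)) {x y : ℝ} (h : x + y = 1) :
    signedArea a b (x • c + y • d) = x * signedArea a b c + y * signedArea a b d := by
  obtain rfl : y = 1 - x := by linarith
  simp only [signedArea, PiLp.add_apply, PiLp.smul_apply, smul_eq_mul]
  ring

/-- Points strictly on one side of the line `ab` span a segment that misses the segment `ab`. -/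
theorem openSegment_inter_eq_empty_of_signedArea_pos {a b c d : EuclideanSpace ℝ (Fin 2)}
    (hc : 0 < signedArea a b c) (hd : 0 < signedArea a b d) :
    openSegment ℝ a b ∩ openSegment ℝ c d = ∅ := by
  rw [Set.eq_empty_iff_forall_notMem]
  rintro p ⟨⟨x, y, hx, hy, hxy, rfl⟩, ⟨z, w, hz, hw, hzw, hp⟩⟩
  have h1 := signedArea_lineMap a b a b hxy
  have h2 := signedArea_lineMap a b c d hzw
  rw [hp, h1] at h2
  have h3 : signedArea a b a = 0 := by unfold signedArea; ring
  have h4 : signedArea a b b = 0 := by unfold signedArea; ring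
  rw [h3, h4] at h2
  have := mul_pos hz hc
  have := mul_pos hw hd
  linarith

/-- Barycentric coordinates without normalization. In the applications the weights are signed areas
of subtriangles, for which `h0` and `h1` are polynomial identities. -/
theorem mem_convexHull_triple {a b c p : EuclideanSpace ℝ (Fin 2)} {x y z : ℝ} (hx : 0 ≤ x)
    (hy : 0 ≤ y) (hz : 0 ≤ z) (hs : 0 < x + y + z)
    (h0 : (x + y + z) * p 0 = x * a 0 + y * b 0 + z * c 0)
    (h1 : (x + y + z) * p 1 = x * a 1 + y * b 1 + z * c 1) :
    p ∈ convexHull ℝ {a, b, c} := by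
  have hp : p = (x / (x + y + z)) • a + (y / (x + y + z)) • b + (z / (x + y + z)) • c := by
    ext i
    fin_cases i
    · simp
      field_simp
      linarith
    · simp
      field_simp
      linarith
  have hconv := convex_convexHull ℝ ({a, b, c} : Set (EuclideanSpace ℝ (Fin 2)))
  have hsub := subset_convexHull ℝ ({a, b, c} : Set (EuclideanSpace ℝ (Fin 2)))
  have := hconv.sum_mem (t := Finset.univ)
    (w := ![x / (x + y + z), y / (x + y + z), z / (x + y + z)]) (z := ![a, b, c])
    (by intro i _; fin_cases i <;> simp <;> positivity)
    (by simp [Fin.sum_univ_three]; field_simp)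
    (by intro i _; fin_cases i <;> apply hsub <;> simp)
  rw [hp]
  simpa [Fin.sum_univ_three] using this

/-! ### Convex position and counterclockwise numbering -/

namespace GeometricGraph

variable {V : Type*} (K : GeometricGraph V)

theorem signedArea_ne_zero {a b c : V} (hab : a ≠ b) (hbc : b ≠ c) (hac : a ≠ c) :
    signedArea (K.pos a) (K.pos b) (K.pos c) ≠ 0 := fun h =>
  K.general_position a b c hab hbc hac
    (collinear_of_signedArea_eq_zero (K.pos_injective.ne hab) h)

variable {K}

theorem InConvexPosition.notMem (h : K.InConvexPosition) {a b c p : V} (ha : p ≠ a) (hb : p ≠ b)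
    (hc : p ≠ c) : K.pos p ∉ convexHull ℝ {K.pos a, K.pos b, K.pos c} := by
  intro hp
  have := h {a, b, c} p (by simpa [Set.image_insert_eq] using hp)
  simp only [Set.mem_insert_iff, Set.mem_singleton_iff] at this
  tauto

/-- Seen from a fixed vertex, the counterclockwise relation on the others is transitive. -/
theorem InConvexPosition.signedArea_trans (h : K.InConvexPosition) {p a b c : V}
    (ha : p ≠ a) (hb : p ≠ b) (hc : p ≠ c)
    (hab : 0 < signedArea (K.pos p) (K.pos a) (K.pos b))
    (hbc : 0 < signedArea (K.pos p) (K.pos b) (K.pos c)) :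
    0 < signedArea (K.pos p) (K.pos a) (K.pos c) := by
  by_contra hn
  have hca : 0 ≤ signedArea (K.pos p) (K.pos c) (K.pos a) := by
    rw [signedArea_swap]; linarith [not_lt.1 hn]
  -- Otherwise `p` lies in the triangle `abc`, its weights being the areas of the triangles that `p`
  -- spans with the opposite sides.
  refine h.notMem ha hb hc (mem_convexHull_triple hbc.le hca hab.le (by linarith) ?_ ?_) <;>
  · unfold signedArea
    ring

/-- If `abc` were not counterclockwise, `b` would lie in the triangle `pac`, again with subtriangle
areas as weights. -/
theorem InConvexPosition.signedArea_pos (h : K.InConvexPosition) {p a b c : V}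
    (hb : p ≠ b) (hab' : a ≠ b) (hbc' : b ≠ c)
    (hab : 0 < signedArea (K.pos p) (K.pos a) (K.pos b))
    (hbc : 0 < signedArea (K.pos p) (K.pos b) (K.pos c))
    (hac : 0 < signedArea (K.pos p) (K.pos a) (K.pos c)) :
    0 < signedArea (K.pos a) (K.pos b) (K.pos c) := by
  by_contra hn
  push Not at hn
  have key : signedArea (K.pos p) (K.pos a) (K.pos c) - signedArea (K.pos p) (K.pos b) (K.pos c)
      - signedArea (K.pos p) (K.pos a) (K.pos b) = - signedArea (K.pos a) (K.pos b) (K.pos c) := by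
    unfold signedArea; ring
  refine h.notMem (a := p) (b := a) (c := c) hb.symm hab'.symm hbc'
    (mem_convexHull_triple (x := - signedArea (K.pos a) (K.pos b) (K.pos c))
      (by linarith) hbc.le hab.le (by linarith) ?_ ?_) <;>
  · unfold signedArea
    ring

/-- Vertices in convex position can be numbered in counterclockwise order. -/
theorem InConvexPosition.exists_equiv [Fintype V] [Nonempty V] (h : K.InConvexPosition) {n : ℕ}
    (hn : Fintype.card V = n) : ∃ σ : Fin n ≃ V, ∀ i j k : Fin n, i < j → j < k →
      0 < signedArea (K.pos (σ i)) (K.pos (σ j)) (K.pos (σ k)) := by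
  classical
  obtain ⟨p⟩ := ‹Nonempty V›
  -- Sort the vertices by angle around `p`, with `p` itself as least element.
  let lt : V → V → Prop := fun a b =>
    b ≠ p ∧ (a = p ∨ 0 < signedArea (K.pos p) (K.pos a) (K.pos b))
  have self0 : ∀ a b, signedArea a b b = 0 := fun a b => by unfold signedArea; ring
  have hsto : IsStrictTotalOrder V lt :=
    { irrefl := by
        rintro a ⟨h1, h2 | h2⟩
        · exact h1 h2
        · rw [self0] at h2; exact lt_irrefl _ h2
      trans := by
        rintro a b c ⟨h1, h2⟩ ⟨h3, h4⟩
        refine ⟨h3, ?_⟩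
        have h4 := h4.resolve_left h1
        by_cases hap : a = p
        · exact Or.inl hap
        · exact Or.inr (h.signedArea_trans (Ne.symm hap) h1.symm h3.symm
            (h2.resolve_left hap) h4)
      trichotomous := by
        intro a b h1 h2
        by_contra hab
        simp only [lt, not_and_or, not_or, not_not, not_lt] at h1 h2
        by_cases hap : a = p
        · subst hap
          rcases h1 with h1 | h1
          · exact hab h1.symm
          · exact h1.1 rfl
        · by_cases hbp : b = p
          · rcases h2 with h2 | h2
            · exact hap h2
            · exact h2.1 hbp
          · have h1 := (h1.resolve_left hbp).2
            have h2 := (h2.resolve_left hap).2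
            rw [signedArea_swap] at h2
            exact K.signedArea_ne_zero (Ne.symm hap) hab (Ne.symm hbp) (by linarith) }
  let : LinearOrder V := linearOrderOfSTO lt
  refine ⟨(Fintype.orderIsoFinOfCardEq V hn).toEquiv, fun i j k hij hjk => ?_⟩
  set e := Fintype.orderIsoFinOfCardEq V hn
  have h1 : lt (e i) (e j) := e.lt_iff_lt.2 hij
  have h2 : lt (e j) (e k) := e.lt_iff_lt.2 hjk
  have h3 : lt (e i) (e k) := e.lt_iff_lt.2 (hij.trans hjk)
  have h2' := h2.2.resolve_left h1.1
  change 0 < signedArea (K.pos (e i)) (K.pos (e j)) (K.pos (e k))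
  by_cases hip : e i = p
  · rwa [hip]
  · exact h.signedArea_pos h1.1.symm (e.injective.ne hij.ne) (e.injective.ne hjk.ne)
      (h1.2.resolve_left hip) h2' (h3.2.resolve_left hip)

/-- The vertices of a numbering `σ`, read off periodically. -/
def cyc {n : ℕ} [NeZero n] (σ : Fin n ≃ V) (m : ℕ) : V :=
  σ (Fin.ofNat n m)

theorem cyc_eq_iff {n : ℕ} [NeZero n] (σ : Fin n ≃ V) {a b : ℕ} :
    cyc σ a = cyc σ b ↔ (a : ZMod n) = b := by
  rw [ZMod.natCast_eq_natCast_iff', cyc, cyc, σ.apply_eq_iff_eq, Fin.ext_iff]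
  rfl

variable (K) in
/-- The vertices `σ 0, σ 1, …` are in counterclockwise order around the convex polygon. -/
def IsCounterclockwise {n : ℕ} (σ : Fin n ≃ V) : Prop :=
  ∀ i j k : Fin n, i < j → j < k → 0 < signedArea (K.pos (σ i)) (K.pos (σ j)) (K.pos (σ k))

theorem IsCounterclockwise.cyc_pos {n : ℕ} [NeZero n] {σ : Fin n ≃ V}
    (hσ : K.IsCounterclockwise σ) {a b c : ℕ} (hab : a < b) (hbc : b < c) (hca : c < a + n) :
    0 < signedArea (K.pos (cyc σ a)) (K.pos (cyc σ b)) (K.pos (cyc σ c)) := by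
  have hn : 0 < n := Nat.pos_of_neZero n
  have hlt : ∀ x y : ℕ, x % n < y % n → Fin.ofNat n x < Fin.ofNat n y := fun x y h => h
  -- Reduction mod `n` either keeps the order of two indices less than `n` apart or wraps exactly
  -- once; a wrap only rotates the triple cyclically.
  have hmod : ∀ x y : ℕ, x < y → y < x + n → (x % n < y % n ∧ y % n - x % n = y - x) ∨
      (y % n < x % n ∧ y % n + n - x % n = y - x) := by
    intro x y hxy hy
    have hx1 := Nat.mod_lt x hn
    have hy1 := Nat.mod_lt y hn
    have hx2 := Nat.div_add_mod x n
    have hy2 := Nat.div_add_mod y n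
    have hq : y / n = x / n ∨ y / n = x / n + 1 := by
      have h1 : x / n ≤ y / n := Nat.div_le_div_right hxy.le
      have h2 : y / n ≤ (x + n) / n := Nat.div_le_div_right hy.le
      rw [Nat.add_div_right _ hn] at h2
      omega
    rcases hq with hq | hq
    · rw [hq] at hy2; omega
    · rw [hq, Nat.mul_add] at hy2; omega
  have h1 := hmod a b hab (by omega)
  have h2 := hmod b c hbc (by omega)
  have h3 := hmod a c (by omega) hca
  rcases h1 with h1 | h1
  · rcases h2 with h2 | h2
    · exact hσ _ _ _ (hlt _ _ h1.1) (hlt _ _ h2.1)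
    · rw [← signedArea_rotate, ← signedArea_rotate]
      exact hσ _ _ _ (hlt _ _ (by omega)) (hlt _ _ h1.1)
  · rw [← signedArea_rotate]
    exact hσ _ _ _ (hlt _ _ (by omega)) (hlt _ _ (by omega))

/-- Two chords of the polygon whose ends do not interleave do not cross. -/
theorem IsCounterclockwise.not_crosses {n : ℕ} [NeZero n] {σ : Fin n ≃ V}
    (hσ : K.IsCounterclockwise σ) {t a b c d : ℕ} (ha : t ≤ a) (hab : a < b) (hb : b < t + n)
    (hc : t ≤ c) (hc' : c < t + n) (hd : t ≤ d) (hd' : d < t + n)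
    (h : (a < c ∧ c < b ∧ a < d ∧ d < b) ∨ ((c < a ∨ b < c) ∧ (d < a ∨ b < d))) :
    ¬ K.Crosses (cyc σ a) (cyc σ b) (cyc σ c) (cyc σ d) := by
  rw [Crosses, Set.not_nonempty_iff_eq_empty]
  rcases h with ⟨h1, h2, h3, h4⟩ | ⟨h1, h2⟩
  · rw [openSegment_symm]
    apply openSegment_inter_eq_empty_of_signedArea_pos
    · rw [← signedArea_rotate]; exact hσ.cyc_pos h1 h2 (by omega)
    · rw [← signedArea_rotate]; exact hσ.cyc_pos h3 h4 (by omega)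
  · have key : ∀ x, t ≤ x → x < t + n → (x < a ∨ b < x) →
        0 < signedArea (K.pos (cyc σ a)) (K.pos (cyc σ b)) (K.pos (cyc σ x)) := by
      rintro x hx hx' (h | h)
      · rw [signedArea_rotate]; exact hσ.cyc_pos h hab (by omega)
      · exact hσ.cyc_pos hab h (by omega)
    exact openSegment_inter_eq_empty_of_signedArea_pos (key c hc hc' h1) (key d hd hd' h2)

end GeometricGraph

/-! ### Peltesohn's difference triples -/

/-- First entry of the `r`-th triple `(0, y, z)` of family `f` in Peltesohn's cyclic Steiner triple
system of order `18 * s + 1`. -/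
def peltesohnMid (s : ℕ) (f : Fin 3) (r : ℕ) : ℕ :=
  match f with
  | 0 => 4 * s - r + 1
  | 1 => 8 * s - r
  -- At `r = s - 1` the general formulas would give `4 * s + 1` and `7 * s + 1`, already the middle
  -- entries of family 0 at `r = 0` and family 1 at `r = s - 1`. The replacements keep the
  -- difference `3 * s`.
  | 2 => if r + 1 = s then 3 * s + 1 else 6 * s - 2 * r - 1

/-- Last entry of the `r`-th triple `(0, y, z)` of family `f` in Peltesohn's cyclic Steiner triple
system of order `18 * s + 1`. -/
def peltesohnEnd (s : ℕ) (f : Fin 3) (r : ℕ) : ℕ :=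
  match f with
  | 0 => 4 * s + 2 * r + 2
  | 1 => 8 * s + 2 * r + 2
  | 2 => if r + 1 = s then 6 * s + 1 else 6 * s + r + 2

/-- The base triple as a function on its three positions. -/
def peltesohn (s : ℕ) (f : Fin 3) (r : ℕ) (a : Fin 3) : ℕ :=
  match a with
  | 0 => 0
  | 1 => peltesohnMid s f r
  | 2 => peltesohnEnd s f r

/-- Every nonzero residue is a difference of a base triple. -/
theorem exists_peltesohn_sub (s d : ℕ) (hd : 0 < d) (hd' : d ≤ 9 * s) :
    ∃ f : Fin 3, ∃ r < s, ∃ a b : Fin 3, a ≠ b ∧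
      (peltesohn s f r b = peltesohn s f r a + d ∨
        peltesohn s f r b + (18 * s + 1) = peltesohn s f r a + d) := by
  have main : ∀ (f : Fin 3) (r : ℕ), r < s →
      (peltesohnMid s f r = d ∨ peltesohnEnd s f r = d ∨
        peltesohnEnd s f r = peltesohnMid s f r + d ∨ peltesohnEnd s f r + d = 18 * s + 1) →
      ∃ f : Fin 3, ∃ r < s, ∃ a b : Fin 3, a ≠ b ∧
      (peltesohn s f r b = peltesohn s f r a + d ∨
        peltesohn s f r b + (18 * s + 1) = peltesohn s f r a + d) := by
    intro f r hr h
    rcases h with h | h | h | h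
    · exact ⟨f, r, hr, 0, 1, by decide, Or.inl (by simp [peltesohn, h])⟩
    · exact ⟨f, r, hr, 0, 2, by decide, Or.inl (by simp [peltesohn, h])⟩
    · exact ⟨f, r, hr, 1, 2, by decide, Or.inl (by simp [peltesohn, h])⟩
    · exact ⟨f, r, hr, 2, 0, by decide, Or.inr (by simp [peltesohn, h])⟩
  have hdm := Nat.div_add_mod (d - 1) 3
  have hml := Nat.mod_lt (d - 1) (show 0 < 3 by norm_num)
  -- End minus middle is `3 * r + 1`, `3 * r + 2`, `3 * r + 3` in families 0, 1, 2, which covers `1`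
  -- to `3 * s`. Larger `d` come from the middle and end entries; ends of family 1 above `9 * s`
  -- count through their negatives.
  by_cases h1 : d ≤ 3 * s
  · obtain h | h | h : (d - 1) % 3 = 0 ∨ (d - 1) % 3 = 1 ∨ (d - 1) % 3 = 2 := by omega
    · refine main 0 ((d - 1) / 3) (by omega) ?_
      simp only [peltesohnMid, peltesohnEnd]; omega
    · refine main 1 ((d - 1) / 3) (by omega) ?_
      simp only [peltesohnMid, peltesohnEnd]; omega
    · refine main 2 ((d - 1) / 3) (by omega) ?_
      simp only [peltesohnMid, peltesohnEnd]; split_ifs <;> omega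
  by_cases h2 : d = 3 * s + 1 ∨ d = 6 * s + 1
  · refine main 2 (s - 1) (by omega) ?_
    simp only [peltesohnMid, peltesohnEnd]; split_ifs <;> omega
  by_cases h3 : d ≤ 4 * s + 1
  · refine main 0 (4 * s + 1 - d) (by omega) ?_
    simp only [peltesohnMid, peltesohnEnd]; omega
  by_cases h4 : d ≤ 6 * s
  · by_cases h5 : d % 2 = 0
    · refine main 0 ((d - (4 * s + 2)) / 2) (by omega) ?_
      simp only [peltesohnMid, peltesohnEnd]; omega
    · refine main 2 ((6 * s - 1 - d) / 2) (by omega) ?_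
      simp only [peltesohnMid, peltesohnEnd]; split_ifs <;> omega
  by_cases h5 : d ≤ 7 * s
  · refine main 2 (d - (6 * s + 2)) (by omega) ?_
    simp only [peltesohnMid, peltesohnEnd]; split_ifs <;> omega
  by_cases h6 : d ≤ 8 * s
  · refine main 1 (8 * s - d) (by omega) ?_
    simp only [peltesohnMid, peltesohnEnd]; omega
  by_cases h7 : d % 2 = 0
  · refine main 1 ((d - (8 * s + 2)) / 2) (by omega) ?_
    simp only [peltesohnMid, peltesohnEnd]; omega
  · refine main 1 ((10 * s - 1 - d) / 2) (by omega) ?_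
    simp only [peltesohnMid, peltesohnEnd]; omega

theorem exists_natCast_peltesohn_sub (s : ℕ) (d : ZMod (18 * s + 1)) (hd : d ≠ 0) :
    ∃ f : Fin 3, ∃ r < s, ∃ a b : Fin 3, a ≠ b ∧
      (peltesohn s f r b : ZMod (18 * s + 1)) - peltesohn s f r a = d := by
  have main : ∀ m : ℕ, 0 < m → m ≤ 9 * s → ∃ f : Fin 3, ∃ r < s, ∃ a b : Fin 3, a ≠ b ∧
      (peltesohn s f r b : ZMod (18 * s + 1)) - peltesohn s f r a = m := by
    intro m hm hm'
    obtain ⟨f, r, hr, a, b, hab, h⟩ := exists_peltesohn_sub s m hm hm'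
    refine ⟨f, r, hr, a, b, hab, ?_⟩
    have hn : ((18 * s + 1 : ℕ) : ZMod (18 * s + 1)) = 0 := ZMod.natCast_self _
    rw [sub_eq_iff_eq_add']
    rcases h with h | h
    · rw [h, Nat.cast_add]
    · have := congrArg (Nat.cast : ℕ → ZMod (18 * s + 1)) h
      rwa [Nat.cast_add, hn, add_zero, Nat.cast_add] at this
  have hv := ZMod.val_lt d
  have hv0 : d.val ≠ 0 := (ZMod.val_ne_zero d).2 hd
  by_cases h : d.val ≤ 9 * s
  · simpa using main d.val (by omega) h
  · obtain ⟨f, r, hr, a, b, hab, h⟩ := main (18 * s + 1 - d.val) (by omega) (by omega)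
    refine ⟨f, r, hr, b, a, hab.symm, ?_⟩
    rw [Nat.cast_sub hv.le, ZMod.natCast_self, ZMod.natCast_zmod_val] at h
    linear_combination -h

/-- Distinct pairs of positions in the base triples have distinct differences. -/
theorem peltesohn_sub_injective (s : ℕ) {i i' : Fin 3 × Fin s} {a b a' b' : Fin 3} (hab : a ≠ b)
    (hab' : a' ≠ b')
    (h : (peltesohn s i.1 i.2 b : ZMod (18 * s + 1)) - peltesohn s i.1 i.2 a =
      peltesohn s i'.1 i'.2 b' - peltesohn s i'.1 i'.2 a') : i = i' ∧ a = a' ∧ b = b' := by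
  let X := (Fin 3 × Fin s) × {p : Fin 3 × Fin 3 // p.1 ≠ p.2}
  let F : X → ZMod (18 * s + 1) := fun x =>
    (peltesohn s x.1.1 x.1.2 x.2.1.2 : ZMod (18 * s + 1)) - peltesohn s x.1.1 x.1.2 x.2.1.1
  have hcard : Fintype.card X = 18 * s := by
    have : Fintype.card {p : Fin 3 × Fin 3 // p.1 ≠ p.2} = 6 := by decide
    simp only [X, Fintype.card_prod, Fintype.card_fin, this]
    ring
  -- The `18 * s` ordered pairs of positions map onto the `18 * s` nonzero residues, so by counting
  -- the map is injective.
  have himg : (Finset.univ.erase (0 : ZMod (18 * s + 1))) ⊆ Finset.univ.image F := by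
    intro d hd
    obtain ⟨f, r, hr, a, b, hab, h⟩ := exists_natCast_peltesohn_sub s d (Finset.ne_of_mem_erase hd)
    exact Finset.mem_image.2 ⟨((f, ⟨r, hr⟩), ⟨(a, b), hab⟩), Finset.mem_univ _, h⟩
  have hinj : Set.InjOn F (Finset.univ : Finset X) := by
    apply Finset.injOn_of_card_image_eq
    refine le_antisymm Finset.card_image_le ?_
    have := Finset.card_le_card himg
    rw [Finset.card_erase_of_mem (Finset.mem_univ _), Finset.card_univ, ZMod.card] at this
    rw [Finset.card_univ, hcard]
    exact this
  have := hinj (x₁ := (i, ⟨(a, b), hab⟩)) (x₂ := (i', ⟨(a', b'), hab'⟩)) (by simp) (by simp) h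
  obtain ⟨h1, h2⟩ := Prod.mk.inj this
  exact ⟨h1, Prod.mk.inj (Subtype.mk.inj h2)⟩

/-! ### Chains of nested triangles and color classes -/

/-- The index of the chain of nested triangles that contains the `r`-th triangle of family `f`. -/
def chainIndex (s : ℕ) (f : Fin 3) (r : ℕ) : ℕ :=
  match f with
  | 0 => r
  | 1 => r
  | 2 => s - 3 - r

/-- How far a triangle of family `f` is shifted against the outermost triangle of its chain. -/
def chainShift (f : Fin 3) : ℕ :=
  match f with
  | 0 => 2
  | 1 => 0
  | 2 => 1

/-- Where the chain of index `j` starts. The chains of indices `j` and `s - 3 - j` lie side by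
side. -/
def chainStart (s j : ℕ) : ℕ :=
  -- The later chain starts one step past the end of its partner, which spans `8 * s + 2 * (s - 3 -
  -- j) + 2`.
  if 2 * j < s - 3 then 0 else 8 * s + 2 * (s - 3 - j) + 3

/-- The place of the `r`-th triangle of family `f` in its color class. -/
def offset (s : ℕ) (f : Fin 3) (r : ℕ) : ℕ :=
  if r + 3 ≤ s then chainStart s (chainIndex s f r) + chainShift f else 0

/-- The color class, up to rotation, of the `r`-th triangle of family `f`. -/
def colorClass (s : ℕ) (f : Fin 3) (r : ℕ) : ℕ :=
  if r + 3 ≤ s then min (chainIndex s f r) (s - 3 - chainIndex s f r)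
  -- For the leftovers `r = s - 1` and `r = s - 2` the last two terms encode `(f, r)` injectively by
  -- `0` to `5`; chain classes stay below `s / 2`.
  else s / 2 + 2 * f + (s - 1 - r)

theorem colorClass_lt {s : ℕ} {f : Fin 3} {r : ℕ} (hr : r < s) : colorClass s f r < s / 2 + 6 := by
  unfold colorClass
  split_ifs <;> omega

theorem chainStart_spec (s j : ℕ) : (2 * j < s - 3 ∧ chainStart s j = 0) ∨
    (s - 3 ≤ 2 * j ∧ chainStart s j = 8 * s + 2 * (s - 3 - j) + 3) := by
  unfold chainStart
  split_ifs <;> omega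

theorem peltesohn_two_spec (s r : ℕ) :
    (r + 1 = s ∧ peltesohnMid s 2 r = 3 * s + 1 ∧ peltesohnEnd s 2 r = 6 * s + 1) ∨
    (r + 1 ≠ s ∧ peltesohnMid s 2 r = 6 * s - 2 * r - 1 ∧ peltesohnEnd s 2 r = 6 * s + r + 2) := by
  unfold peltesohnMid peltesohnEnd
  dsimp only
  split_ifs <;> omega

theorem fin_three_cases : ∀ f : Fin 3, f = 0 ∨ f = 1 ∨ f = 2 := by
  decide

theorem peltesohnMid_pos {s : ℕ} {f : Fin 3} {r : ℕ} (hr : r < s) : 0 < peltesohnMid s f r := by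
  obtain rfl | rfl | rfl := fin_three_cases f
  · change 0 < 4 * s - r + 1; omega
  · change 0 < 8 * s - r; omega
  · have := peltesohn_two_spec s r; omega

theorem peltesohnMid_lt {s : ℕ} {f : Fin 3} {r : ℕ} (hr : r < s) :
    peltesohnMid s f r < peltesohnEnd s f r := by
  obtain rfl | rfl | rfl := fin_three_cases f
  · change 4 * s - r + 1 < 4 * s + 2 * r + 2; omega
  · change 8 * s - r < 8 * s + 2 * r + 2; omega
  · have := peltesohn_two_spec s r; omega

/-- The triangle on `a' < b' < c'` lies inside the first gap, or beyond the end, of the triangle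
on `a < b < c`. -/
def GapSeparated (a b c a' c' : ℕ) : Prop :=
  (a < a' ∧ c' < b) ∨ c < a'

/-- The data of the triangles that belong to chains, in the form needed for linear arithmetic. -/
theorem chain_spec {s : ℕ} {f : Fin 3} {r : ℕ} (hr : r + 3 ≤ s) :
    ∃ j, j + 3 ≤ s ∧ chainIndex s f r = j ∧ offset s f r = chainStart s j + chainShift f ∧
      ((f = 0 ∧ r = j ∧ chainShift f = 2 ∧ peltesohnMid s f r = 4 * s - j + 1 ∧
          peltesohnEnd s f r = 4 * s + 2 * j + 2) ∨
        (f = 1 ∧ r = j ∧ chainShift f = 0 ∧ peltesohnMid s f r = 8 * s - j ∧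
          peltesohnEnd s f r = 8 * s + 2 * j + 2) ∨
        (f = 2 ∧ r + j + 3 = s ∧ chainShift f = 1 ∧ peltesohnMid s f r = 4 * s + 2 * j + 5 ∧
          peltesohnEnd s f r = 7 * s - j - 1)) := by
  refine ⟨chainIndex s f r, ?_, rfl, by rw [offset, if_pos hr], ?_⟩
  · obtain rfl | rfl | rfl := fin_three_cases f
    · exact hr
    · exact hr
    · change s - 3 - r + 3 ≤ s; omega
  · obtain rfl | rfl | rfl := fin_three_cases f
    · exact Or.inl ⟨rfl, rfl, rfl, rfl, rfl⟩
    · exact Or.inr (Or.inl ⟨rfl, rfl, rfl, rfl, rfl⟩)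
    · refine Or.inr (Or.inr ⟨rfl, ?_, rfl, ?_⟩)
      · change r + (s - 3 - r) + 3 = s; omega
      · have := peltesohn_two_spec s r
        change _ = 4 * s + 2 * (s - 3 - r) + 5 ∧ _ = 7 * s - (s - 3 - r) - 1
        omega

/-- Guarantees that a color class fits in one turn, so that all its triangles lie in a common window
of `n` consecutive indices. -/
theorem offset_add_peltesohnEnd_le {s : ℕ} {f : Fin 3} {r : ℕ} (hr : r < s) :
    offset s f r + peltesohnEnd s f r ≤ 18 * s := by
  by_cases h : r + 3 ≤ s
  · obtain ⟨j, hj, -, ho, h⟩ := chain_spec (f := f) h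
    have := chainStart_spec s j
    rcases h with h | h | h <;> omega
  · rw [offset, if_neg h]
    obtain rfl | rfl | rfl := fin_three_cases f
    · change 0 + (4 * s + 2 * r + 2) ≤ _; omega
    · change 0 + (8 * s + 2 * r + 2) ≤ _; omega
    · have := peltesohn_two_spec s r; omega

theorem gapSeparated_of_colorClass_eq {s : ℕ} (hs : Even s) {f f' : Fin 3} {r r' : ℕ} (hr : r < s)
    (hr' : r' < s) (hne : f ≠ f' ∨ r ≠ r') (h : colorClass s f r = colorClass s f' r') :
    GapSeparated (offset s f r) (offset s f r + peltesohnMid s f r)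
      (offset s f r + peltesohnEnd s f r) (offset s f' r')
      (offset s f' r' + peltesohnEnd s f' r') ∨
    GapSeparated (offset s f' r') (offset s f' r' + peltesohnMid s f' r')
      (offset s f' r' + peltesohnEnd s f' r') (offset s f r)
      (offset s f r + peltesohnEnd s f r) := by
  obtain ⟨m, rfl⟩ := hs
  unfold GapSeparated
  unfold colorClass at h
  by_cases h1 : r + 3 ≤ m + m <;> by_cases h2 : r' + 3 ≤ m + m
  · rw [if_pos h1, if_pos h2] at h
    obtain ⟨j, hj, hj', ho, H⟩ := chain_spec (f := f) h1
    obtain ⟨i, hi, hi', ho', H'⟩ := chain_spec (f := f') h2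
    have hS := chainStart_spec (m + m) j
    have hS' := chainStart_spec (m + m) i
    rw [hj', hi'] at h
    rw [ho, ho']
    -- The triangles lie in the same chain, hence are nested, or in partner chains, hence are side
    -- by side. Parity of `m + m` rules out a chain that is its own partner.
    have hij : i = j ∨ i + j + 3 = m + m := by omega
    clear h ho ho' hj' hi'
    rcases H with ⟨rfl, H⟩ | ⟨rfl, H⟩ | ⟨rfl, H⟩ <;>
    rcases H' with ⟨rfl, H'⟩ | ⟨rfl, H'⟩ | ⟨rfl, H'⟩ <;>
    simp only [ne_eq, not_true_eq_false, false_or] at hne <;>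
    rcases hij with rfl | hij <;> rcases hS with hS | hS <;> rcases hS' with hS' | hS' <;> omega
  · obtain ⟨j, hj, hj', -⟩ := chain_spec (f := f) h1
    rw [if_pos h1, if_neg h2] at h
    omega
  · obtain ⟨j, hj, hj', -⟩ := chain_spec (f := f') h2
    rw [if_neg h1, if_pos h2] at h
    omega
  · rw [if_neg h1, if_neg h2] at h
    exfalso
    rw [ne_eq, Fin.ext_iff] at hne
    omega

/-! ### From triple systems to decompositions of the polygon -/

namespace GeometricGraph

variable {V : Type*} {K : GeometricGraph V}

/-- A Steiner triple system on the vertices of a complete geometric graph, with a coloring of its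
triples in which triples that meet have different colors, bounds a chromatic index. -/
theorem exists_decomposition_of_triples [Finite V] (hK : K.IsComplete) {J : Type*}
    (tri : J → Set V) (h3 : ∀ j, (tri j).ncard = 3)
    (huniq : ∀ u v, u ≠ v → ∃! j, u ∈ tri j ∧ v ∈ tri j) {m : ℕ} (hm : 0 < m) (col : J → Fin m)
    (hcol : ∀ j j', j ≠ j' → col j = col j' →
      ¬ K.Meet ((⊤ : K.graph.Subgraph).induce (tri j)) ((⊤ : K.graph.Subgraph).induce (tri j'))) :
    ∃ P : GraphDecomposition K.graph,
      (∀ H ∈ P.parts, H.IsTriangle) ∧ K.chromaticIndex P ≤ m := by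
  classical
  let part : J → K.graph.Subgraph := fun j => (⊤ : K.graph.Subgraph).induce (tri j)
  have hadj : ∀ u v, K.graph.Adj u v ↔ u ≠ v := by
    intro u v
    rw [show K.graph = ⊤ from hK, SimpleGraph.top_adj]
  have hpart : ∀ j u v, (part j).Adj u v ↔ u ∈ tri j ∧ v ∈ tri j ∧ u ≠ v := by
    intro j u v
    simp [part, SimpleGraph.Subgraph.induce, hadj]
  have hmem : ∀ j u v, s(u, v) ∈ (part j).edgeSet ↔ u ∈ tri j ∧ v ∈ tri j ∧ u ≠ v := by
    intro j u v
    rw [SimpleGraph.Subgraph.mem_edgeSet, hpart]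
  have hedge : ∀ e ∈ K.graph.edgeSet, ∃! j, e ∈ (part j).edgeSet := by
    intro e
    induction e with
    | _ u v =>
      intro he
      rw [SimpleGraph.mem_edgeSet, hadj] at he
      simpa only [hmem, he, ne_eq, not_false_eq_true, and_true] using huniq u v he
  let P : GraphDecomposition K.graph :=
    { parts := Set.range part
      induced := by
        rintro _ ⟨j, rfl⟩ u hu v hv huv
        exact (hpart j u v).2 ⟨hu, hv, (hadj u v).1 huv⟩
      nonempty := by
        rintro _ ⟨j, rfl⟩
        obtain ⟨u, hu, v, hv, huv⟩ := (Set.one_lt_ncard (Set.toFinite (tri j))).1 (by rw [h3]; simp)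
        exact ⟨s(u, v), (hmem j u v).2 ⟨hu, hv, huv⟩⟩
      existsUnique_part := by
        intro e he
        obtain ⟨j, hj, hj'⟩ := hedge e he
        refine ⟨part j, ⟨⟨j, rfl⟩, hj⟩, ?_⟩
        rintro _ ⟨⟨j', rfl⟩, h⟩
        rw [hj' j' h] }
  refine ⟨P, ?_, Nat.sInf_le ⟨hm, fun e => col (hedge e e.2).choose, ?_, ?_⟩⟩
  · rintro _ ⟨j, rfl⟩
    exact ⟨h3 j, fun u hu v hv huv => (hpart j u v).2 ⟨hu, hv, huv⟩⟩
  · rintro _ ⟨j, rfl⟩ e f he hf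
    have h1 := (hedge e e.2).choose_spec.2 j he
    have h2 := (hedge f f.2).choose_spec.2 j hf
    simp only at h1 h2 ⊢
    rw [← h1, ← h2]
  · rintro _ ⟨j, rfl⟩ _ ⟨j', rfl⟩ hne hmeet e f he hf h
    have h1 := (hedge e e.2).choose_spec.2 j he
    have h2 := (hedge f f.2).choose_spec.2 j' hf
    simp only at h1 h2 h
    rw [← h1, ← h2] at h
    exact hcol j j' (fun h => hne (by rw [h])) h hmeet

/-- Triangles in a common window of the polygon, one of them in a gap of the other, do not meet. -/
theorem IsCounterclockwise.not_meet {n : ℕ} [NeZero n] {σ : Fin n ≃ V}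
    (hσ : K.IsCounterclockwise σ) {t a b c a' b' c' : ℕ} (ha : t ≤ a) (hab : a < b) (hbc : b < c)
    (hc : c < t + n) (ha' : t ≤ a') (hab' : a' < b') (hbc' : b' < c') (hc' : c' < t + n)
    (h : GapSeparated a b c a' c' ∨ GapSeparated a' b' c' a c) :
    ¬ K.Meet ((⊤ : K.graph.Subgraph).induce (cyc σ '' {a, b, c}))
      ((⊤ : K.graph.Subgraph).induce (cyc σ '' {a', b', c'})) := by
  unfold GapSeparated at h
  rintro (⟨v, ⟨x, hx, rfl⟩, ⟨y, hy, hxy⟩⟩ | ⟨_, _, _, _, ⟨⟨x, hx, rfl⟩, ⟨y, hy, rfl⟩, hxy⟩,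
    ⟨⟨z, hz, rfl⟩, ⟨w, hw, rfl⟩, hzw⟩, hcross⟩)
  · rw [cyc_eq_iff, ZMod.natCast_eq_natCast_iff] at hxy
    simp only [Set.mem_insert_iff, Set.mem_singleton_iff] at hx hy
    have : (y : ℤ) ≡ x [ZMOD n] := Int.natCast_modEq_iff.2 hxy
    obtain ⟨k, hk⟩ := this.dvd
    -- Congruent indices in a window of length `n` are equal.
    have : y = x := by
      have h1 : (x : ℤ) - y < n := by omega
      have h2 : -(n : ℤ) < (x : ℤ) - y := by omega
      have h3 : (0 : ℤ) < n := by have := Nat.pos_of_neZero n; omega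
      have : k < 1 := by nlinarith
      have : -1 < k := by nlinarith
      obtain rfl : k = 0 := by omega
      simp at hk
      omega
    omega
  · have hxy : x ≠ y := by rintro rfl; exact hxy.ne rfl
    have hzw : z ≠ w := by rintro rfl; exact hzw.ne rfl
    simp only [Set.mem_insert_iff, Set.mem_singleton_iff] at hx hy hz hw
    have key : ∀ x y z w : ℕ, (x = a ∨ x = b ∨ x = c) → (y = a ∨ y = b ∨ y = c) →
        (z = a' ∨ z = b' ∨ z = c') → (w = a' ∨ w = b' ∨ w = c') → x < y → z < w →
        ¬ K.Crosses (cyc σ x) (cyc σ y) (cyc σ z) (cyc σ w) := by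
      intro x y z w hx hy hz hw hxy hzw hcross
      rcases h with h | h
      · refine hσ.not_crosses (t := t) (a := x) (b := y) (c := z) (d := w) (by omega) hxy (by omega)
          (by omega) (by omega) (by omega) (by omega) ?_ hcross
        have : a' ≤ z ∧ z ≤ c' ∧ a' ≤ w ∧ w ≤ c' := by omega
        clear hz hw
        rcases hx with rfl | rfl | rfl <;> rcases hy with rfl | rfl | rfl <;> omega
      · refine hσ.not_crosses (t := t) (a := z) (b := w) (c := x) (d := y) (by omega) hzw (by omega)
          (by omega) (by omega) (by omega) (by omega) ?_ ?_
        · have : a ≤ x ∧ x ≤ c ∧ a ≤ y ∧ y ≤ c := by omega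
          clear hx hy
          rcases hz with rfl | rfl | rfl <;> rcases hw with rfl | rfl | rfl <;> omega
        · rw [Crosses] at hcross ⊢
          rwa [Set.inter_comm]
    have swap : ∀ p q r s : V, K.Crosses p q r s → K.Crosses q p r s := by
      intro p q r s h
      rw [Crosses] at h ⊢
      rwa [openSegment_symm ℝ (K.pos q)]
    have swap' : ∀ p q r s : V, K.Crosses p q r s → K.Crosses p q s r := by
      intro p q r s h
      rw [Crosses] at h ⊢
      rwa [openSegment_symm ℝ (K.pos s)]
    rcases lt_or_gt_of_ne hxy with hxy | hxy <;> rcases lt_or_gt_of_ne hzw with hzw | hzw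
    · exact key x y z w hx hy hz hw hxy hzw hcross
    · exact key x y w z hx hy hw hz hxy hzw (swap' _ _ _ _ hcross)
    · exact key y x z w hy hx hz hw hxy hzw (swap _ _ _ _ hcross)
    · exact key y x w z hy hx hw hz hxy hzw (swap _ _ _ _ (swap' _ _ _ _ hcross))

/-- The triangles of Peltesohn's triple system, drawn on a numbered polygon. -/
def peltesohnTriangle {s : ℕ} (σ : Fin (18 * s + 1) ≃ V)
    (j : (Fin 3 × Fin s) × Fin (18 * s + 1)) : Set V :=
  cyc σ '' {j.2 + offset s j.1.1 j.1.2,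
    j.2 + (offset s j.1.1 j.1.2 + peltesohnMid s j.1.1 j.1.2),
    j.2 + (offset s j.1.1 j.1.2 + peltesohnEnd s j.1.1 j.1.2)}

theorem mem_peltesohnTriangle {s : ℕ} {σ : Fin (18 * s + 1) ≃ V}
    {j : (Fin 3 × Fin s) × Fin (18 * s + 1)} {m : ℕ} : cyc σ m ∈ peltesohnTriangle σ j ↔
      ∃ a : Fin 3, (m : ZMod (18 * s + 1)) =
        (j.2 : ℕ) + offset s j.1.1 j.1.2 + peltesohn s j.1.1 j.1.2 a := by
  rw [Fin.exists_fin_succ, Fin.exists_fin_two]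
  simp only [peltesohnTriangle, Set.mem_image, Set.mem_insert_iff, Set.mem_singleton_iff,
    exists_eq_or_imp, exists_eq_left, cyc_eq_iff, Nat.cast_add, ← add_assoc]
  simp [peltesohn, eq_comm]

theorem existsUnique_peltesohnTriangle {s : ℕ} (σ : Fin (18 * s + 1) ≃ V) {u v : V} (huv : u ≠ v) :
    ∃! j, u ∈ peltesohnTriangle σ j ∧ v ∈ peltesohnTriangle σ j := by
  have hsurj : ∀ w : V, ∃ m : ℕ, cyc σ m = w := fun w =>
    ⟨σ.symm w, by simp [cyc]⟩
  obtain ⟨x, rfl⟩ := hsurj u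
  obtain ⟨y, rfl⟩ := hsurj v
  have hxy : (x : ZMod (18 * s + 1)) ≠ y := fun h => huv ((cyc_eq_iff σ).2 h)
  obtain ⟨f, r, hr, a, b, hab, h⟩ :=
    exists_natCast_peltesohn_sub s ((y : ZMod (18 * s + 1)) - x) (sub_ne_zero.2 hxy.symm)
  simp only [mem_peltesohnTriangle]
  -- The rotation that carries position `a` of the base triple, already moved by its offset, to `x`.
  let z : ZMod (18 * s + 1) := x - peltesohn s f r a - offset s f r
  have hz : ((z.val : ℕ) : ZMod (18 * s + 1)) = x - peltesohn s f r a - offset s f r :=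
    ZMod.natCast_zmod_val z
  refine ⟨((f, ⟨r, hr⟩), ⟨z.val, ZMod.val_lt z⟩), ⟨⟨a, ?_⟩, ⟨b, ?_⟩⟩, ?_⟩
  · simp only [hz]; ring
  · simp only [hz]; linear_combination -h
  · rintro ⟨⟨f', r'⟩, t⟩ ⟨⟨a', ha'⟩, ⟨b', hb'⟩⟩
    have hab' : a' ≠ b' := by
      rintro rfl
      exact hxy (ha'.trans hb'.symm)
    obtain ⟨h1, rfl, rfl⟩ := peltesohn_sub_injective s (i := (f, ⟨r, hr⟩)) (i' := (f', r')) hab hab'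
      (by simp only at ha' hb' ⊢; rw [h, ha', hb']; ring)
    simp only [Prod.mk.injEq] at h1
    obtain ⟨rfl, rfl⟩ := h1
    simp only [Prod.mk.injEq, true_and]
    have : ((t : ℕ) : ZMod (18 * s + 1)) = z.val := by
      rw [hz]; simp only at ha'; rw [ha']; ring
    rw [ZMod.natCast_eq_natCast_iff', Nat.mod_eq_of_lt t.2, Nat.mod_eq_of_lt (ZMod.val_lt z)] at this
    exact Fin.ext this

theorem ncard_peltesohnTriangle {s : ℕ} (σ : Fin (18 * s + 1) ≃ V)
    (j : (Fin 3 × Fin s) × Fin (18 * s + 1)) : (peltesohnTriangle σ j).ncard = 3 := by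
  obtain ⟨⟨f, r⟩, t⟩ := j
  have h1 := peltesohnMid_pos (f := f) r.2
  have h2 := peltesohnMid_lt (f := f) r.2
  have h3 := offset_add_peltesohnEnd_le (f := f) r.2
  have hne : ∀ a b, (t : ℕ) ≤ a → a < b → b < t + (18 * s + 1) → cyc σ a ≠ cyc σ b := by
    intro a b ha hab hb h
    rw [cyc_eq_iff, ZMod.natCast_eq_natCast_iff, Nat.modEq_iff_dvd' hab.le] at h
    have := Nat.le_of_dvd (by omega) h
    omega
  rw [peltesohnTriangle, Set.image_insert_eq, Set.image_pair, Set.ncard_eq_three]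
  simp only
  exact ⟨_, _, _, hne _ _ (by omega) (by omega) (by omega), hne _ _ (by omega) (by omega) (by omega),
    hne _ _ (by omega) (by omega) (by omega), rfl⟩

theorem exists_triangle_decomposition {s : ℕ} (hs : Even s) {K : GeometricGraph (Fin (18 * s + 1))}
    (hK : K.IsComplete) (hconv : K.InConvexPosition) :
    ∃ P : GraphDecomposition K.graph, (∀ H ∈ P.parts, H.IsTriangle) ∧
      K.chromaticIndex P ≤ (s / 2 + 6) * (18 * s + 1) := by
  obtain ⟨σ, hσ⟩ := hconv.exists_equiv (Fintype.card_fin _)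
  replace hσ : K.IsCounterclockwise σ := hσ
  refine exists_decomposition_of_triples hK (peltesohnTriangle σ) (ncard_peltesohnTriangle σ)
    (fun u v => existsUnique_peltesohnTriangle σ) (by positivity)
    -- A color is a class together with a rotation, so triangles of equal color share the window
    -- starting at `t`.
    (fun j => finProdFinEquiv (⟨colorClass s j.1.1 j.1.2, colorClass_lt j.1.2.2⟩, j.2)) ?_
  rintro ⟨⟨f, r⟩, t⟩ ⟨⟨f', r'⟩, t'⟩ hne h
  simp only [EmbeddingLike.apply_eq_iff_eq, Prod.mk.injEq, Fin.mk.injEq] at h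
  obtain ⟨h, rfl⟩ := h
  have hne' : f ≠ f' ∨ (r : ℕ) ≠ r' := by
    by_contra hc
    push Not at hc
    exact hne (by rw [hc.1, Fin.ext hc.2])
  have hsep := gapSeparated_of_colorClass_eq hs r.2 r'.2 hne' h
  have h1 := peltesohnMid_pos (f := f) r.2
  have h2 := peltesohnMid_lt (f := f) r.2
  have h3 := offset_add_peltesohnEnd_le (f := f) r.2
  have h1' := peltesohnMid_pos (f := f') r'.2
  have h2' := peltesohnMid_lt (f := f') r'.2
  have h3' := offset_add_peltesohnEnd_le (f := f') r'.2
  unfold peltesohnTriangle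
  dsimp only
  refine hσ.not_meet (t := t) (by omega) (by omega) (by omega) (by omega)
    (by omega) (by omega) (by omega) (by omega) ?_
  unfold GapSeparated at hsep ⊢
  omega

end GeometricGraph

theorem theorem3p2 :
    ∃ g : ℕ → ℝ, Asymptotics.IsTheta Filter.atTop g (fun n : ℕ => (n : ℝ)) ∧
      ∀ k n : ℕ, Even k → n = 18 * k + 1 →
        ∀ K : GeometricGraph (Fin n), K.IsComplete → K.InConvexPosition →
          ∃ P : GraphDecomposition K.graph,
            (∀ H ∈ P.parts, H.IsTriangle) ∧
              (K.chromaticIndex P : ℝ) ≤ (n : ℝ) ^ 2 / 36 + g n := by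
  -- With `k = 2 * m` and `n = 36 * m + 1`, the bound `(m + 6) * n` is `n ^ 2 / 36 + 6 * n - n /
  -- 36`.
  refine ⟨fun n => 6 * n, (Asymptotics.isTheta_refl _ _).const_mul_left (by norm_num), ?_⟩
  rintro k n hk rfl K hK hconv
  obtain ⟨P, hP, hle⟩ := GeometricGraph.exists_triangle_decomposition hk hK hconv
  refine ⟨P, hP, ?_⟩
  obtain ⟨m, rfl⟩ := hk
  rw [show (m + m) / 2 = m by omega] at hle
  have hle' : (K.chromaticIndex P : ℝ) ≤ ((m + 6) * (18 * (m + m) + 1) : ℕ) := by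
    exact_mod_cast hle
  push_cast at hle' ⊢
  have : (0 : ℝ) ≤ m := m.cast_nonneg
  nlinarith
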